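/- Let $\mathbb{T}=\{\zeta\in\mathbb{C}:|\zeta|=1\}$. For $0<\delta<1$ let $I(\delta)=\{e^{2\pi i x}:|x|<\delta/2\}$ be the open arc centred at $1$ of normalized length $\delta$, and for an integer $N\ge 1$ let $$U_{N,\delta}=\{\zeta\in\mathbb{T}:\zeta^N\in I(\delta)\},$$ which is a union of $N$ open arcs, each of normalized length $\delta/N$ (that is, of arc length $2\pi\delta/N$), centred at the $N$-th roots of unity. Let $\{\Omega(n)\}_{n\ge 1}$ be positive real numbers which decrease (not necessarily strictly) to $0$. Then for any infinite sequence $\{\delta_j\}_j$ of positive real numbers with $\sum_j\delta_j<1$ there exist positive integers $\{N_j\}_j$ such that the compact set $$E=\bigcap_j\bigl(\mathbb{T}\setminus U_{N_j,\delta_j}\bigr)$$ has the following unilateral uniqueness property: whenever $\mu$ is a complex Borel measure of finite total variation supported in $E$ whose Fourier coefficients $\widehat{\mu}(n)=\int_{\mathbb{T}}\zeta^{-n}\,d\mu(\zeta)$ satisfy $$|\widehat{\mu}(n)|\le\Omega(n),\qquad n=1,2,3,\ldots,$$ then $\mu\equiv 0$. -/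

import Mathlib

open MeasureTheory Filter Topology

namespace UnilateralUniqueness

/-- The `n`-th Fourier coefficient `μ̂(n) = ∫ ζ^{-n} dμ(ζ)` of a complex Borel measure `μ` on the
circle. The circle is parametrized as `ζ = e^{2πix}` with `x ∈ ℝ/ℤ`, so that
`ζ^{-n} = e^{-2πinx} = fourier (-n) x`. -/
noncomputable def fourierStieltjesCoeff (μ : ComplexMeasure UnitAddCircle) (n : ℤ) : ℂ :=
  ∫ᵛ x, fourier (-n) x ∂[ContinuousLinearMap.mul ℝ ℂ; μ]

/-- `μ` belongs to `M(E)` for a closed set `E`: its total variation measure is carried by `E`. -/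
def IsSupportedOn (μ : ComplexMeasure UnitAddCircle) (E : Set UnitAddCircle) : Prop :=
  μ.variation Eᶜ = 0

/-- The open arc `I(δ)` centred at `ζ = 1` of normalized length `δ`, that is
`{e^{2πix} : |x| < δ/2}`. -/
def centredArc (δ : ℝ) : Set UnitAddCircle :=
  {x | ‖x‖ < δ / 2}

/-- `U_{N,δ} = {ζ : ζ^N ∈ I(δ)}`: the union of the `N` open arcs of normalized length `δ/N` centred
at the `N`-th roots of unity (the group law on `ℝ/ℤ` is additive, so `ζ^N` is `N • x`). -/
def arcUnion (N : ℕ) (δ : ℝ) : Set UnitAddCircle :=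
  {x | N • x ∈ centredArc δ}

/-- The set `E = ⋂_j (𝕋 ∖ U_{N_j,δ_j})`. -/
def exceptionalSet (N : ℕ → ℕ) (δ : ℕ → ℝ) : Set UnitAddCircle :=
  ⋂ j, (arcUnion (N j) (δ j))ᶜ

end UnilateralUniqueness

/-! Off an open arc about `1` the circle does not separate `0` from infinity, so some polynomial `p`
with `p(0) = 1` is at most `ε` there (`exists_polynomial_norm_le_off_arc`). Integrating `p(ζ^{-N})
ζ^{-n}` against `μ` gives `μ̂(n)` plus a combination of `μ̂(n + kN)`, `k ≥ 1`. The integral is at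
most `ε‖μ‖`, since `μ` lives off `U_{N,δ}`; the other coefficients are small once `N` is large, by
the decay `Ω`. Letting `ε → 0` along `j` kills every `μ̂(n)`, including negative `n`. -/

/-- Summing the partial sums of `∑ z^(k+1)` gives a closed form of Fejér type. -/
lemma one_sub_sq_mul_sum_geom (z : ℂ) (n : ℕ) :
    (1 - z) ^ 2 * ∑ j ∈ Finset.range n, ∑ k ∈ Finset.range (j + 1), z ^ (k + 1) =
      n * (z * (1 - z)) - z ^ 2 * (1 - z ^ n) := by
  have inner (j : ℕ) : (1 - z) * ∑ k ∈ Finset.range (j + 1), z ^ (k + 1) =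
      z * (1 - z ^ (j + 1)) := by
    have h := mul_neg_geom_sum z (j + 1)
    simp_rw [pow_succ' z, ← Finset.mul_sum]
    rw [mul_left_comm, h, pow_succ' z j]
  induction n with
  | zero => simp
  | succ n ih =>
    rw [Finset.sum_range_succ, mul_add, ih]
    push_cast
    linear_combination (1 - z) * inner n

lemma re_div_one_sub_of_norm_eq_one {z : ℂ} (hz : ‖z‖ = 1) (h1 : z ≠ 1) :
    (z / (1 - z)).re = -1 / 2 := by
  have hsq : z.re * z.re + z.im * z.im = 1 := by
    rw [← Complex.normSq_apply, Complex.normSq_eq_norm_sq, hz, one_pow]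
  have hns : Complex.normSq (1 - z) = 2 * (1 - z.re) := by
    rw [Complex.normSq_apply]
    simp only [Complex.sub_re, Complex.one_re, Complex.sub_im, Complex.one_im]
    linear_combination hsq
  have hne : 1 - z.re ≠ 0 := by
    intro h
    apply h1
    have hre : z.re = 1 := by linarith
    have him : z.im = 0 := by
      rw [hre] at hsq
      nlinarith
    exact Complex.ext (by simpa using hre) (by simpa using him)
  rw [Complex.div_re, hns]
  simp only [Complex.sub_re, Complex.one_re, Complex.sub_im, Complex.one_im]
  field_simp
  linear_combination -hsq

/-- The main term of the closed form is `n * z / (1 - z)`, on the line of real part `-n / 2`; the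
remainder is bounded independently of `n`. -/
lemma re_sum_geom_le {z : ℂ} (hz : ‖z‖ = 1) {c : ℝ} (hc : 0 < c) (hcz : c ≤ ‖1 - z‖) (n : ℕ) :
    (∑ j ∈ Finset.range n, ∑ k ∈ Finset.range (j + 1), z ^ (k + 1)).re ≤ -n / 2 + 2 / c ^ 2 := by
  have h1 : 1 - z ≠ 0 := norm_pos_iff.1 (hc.trans_le hcz)
  have key : ∑ j ∈ Finset.range n, ∑ k ∈ Finset.range (j + 1), z ^ (k + 1) =
      (n : ℝ) * (z / (1 - z)) - z ^ 2 * (1 - z ^ n) / (1 - z) ^ 2 := by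
    rw [← mul_right_inj' (pow_ne_zero 2 h1), one_sub_sq_mul_sum_geom]
    push_cast
    field_simp
  have hr : ‖z ^ 2 * (1 - z ^ n) / (1 - z) ^ 2‖ ≤ 2 / c ^ 2 := by
    rw [norm_div, norm_mul, norm_pow, norm_pow, hz, one_pow, one_mul]
    have : ‖1 - z ^ n‖ ≤ 2 := (norm_sub_le _ _).trans (by simp [hz]; norm_num)
    gcongr
  rw [key, Complex.sub_re, Complex.re_ofReal_mul,
    re_div_one_sub_of_norm_eq_one hz (fun h => h1 (by simp [h]))]
  linarith [(abs_le.1 ((Complex.abs_re_le_norm _).trans hr)).1]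

lemma isCompact_le_norm (r : ℝ) : IsCompact {y : UnitAddCircle | r ≤ ‖y‖} :=
  (isClosed_le continuous_const continuous_norm).isCompact

lemma norm_fourier_apply (n : ℤ) (y : UnitAddCircle) : ‖fourier n y‖ = 1 :=
  Circle.norm_coe _

lemma exists_le_norm_one_sub_fourier {r : ℝ} (hr : 0 < r) :
    ∃ c : ℝ, 0 < c ∧ ∀ y : UnitAddCircle, r ≤ ‖y‖ → c ≤ ‖1 - fourier 1 y‖ := by
  refine (isCompact_le_norm r).exists_forall_le' (a := 0)
    (f := fun y : UnitAddCircle => ‖1 - fourier 1 y‖) (by fun_prop) fun y hy => ?_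
  rw [norm_pos_iff, sub_ne_zero]
  intro h
  have h0 : y = 0 := by
    apply AddCircle.injective_toCircle (one_ne_zero (α := ℝ))
    apply Circle.ext
    rw [← fourier_one, ← h, AddCircle.toCircle_zero, Circle.coe_one]
  rw [Set.mem_ofPred_eq, h0, norm_zero] at hy
  exact hr.not_ge hy

open Polynomial in
/-- Off an arc centred at `1` there are arbitrarily small polynomials with constant term `1`. -/
theorem exists_polynomial_norm_le_off_arc {r ε : ℝ} (hr : 0 < r) (hε : 0 < ε) :
    ∃ p : ℂ[X], p.coeff 0 = 1 ∧
      ∀ y : UnitAddCircle, r ≤ ‖y‖ → ‖p.eval (fourier 1 y)‖ ≤ ε := by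
  obtain ⟨c, hc, hcy⟩ := exists_le_norm_one_sub_fourier hr
  obtain ⟨n, hn⟩ := exists_nat_ge (2 * (1 + 2 / c ^ 2))
  set U : ℂ[X] := ∑ j ∈ Finset.range n, ∑ k ∈ Finset.range (j + 1), X ^ (k + 1) with hU
  have hre (y : UnitAddCircle) (hy : r ≤ ‖y‖) : (U.eval (fourier 1 y)).re ≤ -1 := by
    have h := re_sum_geom_le (norm_fourier_apply 1 y) hc (hcy y hy) n
    simp only [hU, eval_finsetSum, eval_pow, eval_X]
    linarith
  obtain ⟨B, hB⟩ := (isCompact_le_norm r).exists_bound_of_continuousOn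
    (f := fun y : UnitAddCircle => U.eval (fourier 1 y)) (by fun_prop)
  -- From `Re u ≤ -1` and `|u| ≤ B`, `|1 + tu|² ≤ 1 - 2t + t²B²`; this `t` makes `tB² ≤ 1`, hence
  -- the bound `1 - t`.
  set t : ℝ := 1 / (B ^ 2 + 1) with ht
  have ht0 : 0 < t := by positivity
  have ht1 : t ≤ 1 := by
    rw [ht, div_le_one (by positivity)]
    linarith [sq_nonneg B]
  have htB : t * (B ^ 2 + 1) = 1 := by rw [ht]; field_simp
  obtain ⟨m, hm⟩ := exists_pow_lt_of_lt_one hε (show 1 - t < 1 by linarith)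
  -- `U` has no constant term, so every power keeps constant term `1`.
  refine ⟨((1 + C (t : ℂ) * U) ^ 2) ^ m, ?_, fun y hy => ?_⟩
  · simp [coeff_zero_eq_eval_zero, hU, eval_finsetSum]
  · have hn := hB y hy
    have hr' := hre y hy
    set u := U.eval (fourier 1 y) with hu
    have hsq : ‖1 + (t : ℂ) * u‖ ^ 2 ≤ 1 - t := by
      have h2 : ‖u‖ ^ 2 ≤ B ^ 2 := by gcongr
      rw [← Complex.normSq_eq_norm_sq, Complex.normSq_apply] at h2 ⊢
      simp only [Complex.add_re, Complex.one_re, Complex.re_ofReal_mul, Complex.add_im,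
        Complex.one_im, Complex.im_ofReal_mul]
      nlinarith [mul_le_mul_of_nonneg_left h2 (sq_nonneg t),
        mul_le_mul_of_nonneg_left hr' ht0.le]
    simp only [eval_pow, eval_add, eval_one, eval_mul, eval_C, norm_pow]
    exact (pow_le_pow_left₀ (by positivity) hsq m).trans hm.le

/-- The variation is dominated by the total variations of the real and imaginary parts. -/
instance isFiniteMeasure_variation_complexMeasure {X : Type*} [MeasurableSpace X]
    (μ : ComplexMeasure X) : IsFiniteMeasure μ.variation := by
  have : IsFiniteMeasure (ComplexMeasure.re μ).totalVariation := by
    unfold SignedMeasure.totalVariation; infer_instance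
  have : IsFiniteMeasure (ComplexMeasure.im μ).totalVariation := by
    unfold SignedMeasure.totalVariation; infer_instance
  refine isFiniteMeasure_of_le
    ((ComplexMeasure.re μ).totalVariation + (ComplexMeasure.im μ).totalVariation)
    (VectorMeasure.variation_le_of_forall_enorm_le fun s hs => ?_)
  have h : μ s = ((ComplexMeasure.re μ s : ℝ) : ℂ) +
      ((ComplexMeasure.im μ s : ℝ) : ℂ) * Complex.I := (Complex.re_add_im (μ s)).symm
  calc ‖μ s‖ₑ ≤ ‖((ComplexMeasure.re μ s : ℝ) : ℂ)‖ₑ +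
        ‖((ComplexMeasure.im μ s : ℝ) : ℂ) * Complex.I‖ₑ := by
        rw [h]; exact enorm_add_le _ _
    _ = ‖ComplexMeasure.re μ s‖ₑ + ‖ComplexMeasure.im μ s‖ₑ := by
        simp [← ofReal_norm]
    _ ≤ _ := by
        rw [Measure.add_apply]
        exact add_le_add (SignedMeasure.enorm_le_totalVariation _ _)
          (SignedMeasure.enorm_le_totalVariation _ _)

lemma integral_const_mul_complexMeasure {X : Type*} [MeasurableSpace X] (μ : ComplexMeasure X)
    (c : ℂ) (f : X → ℂ) :
    ∫ᵛ x, c * f x ∂[ContinuousLinearMap.mul ℝ ℂ; μ] =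
      c * ∫ᵛ x, f x ∂[ContinuousLinearMap.mul ℝ ℂ; μ] := by
  rw [VectorMeasure.integral_eq_setToFun, VectorMeasure.integral_eq_setToFun]
  refine setToFun_smul _ (fun c s x => ?_) c f
  rw [transpose_eq_cbmApplyMeasure]
  simp [mul_assoc]

lemma integrable_continuousMap_variation (μ : ComplexMeasure UnitAddCircle)
    (f : C(UnitAddCircle, ℂ)) : μ.Integrable f :=
  f.continuous.integrable_of_hasCompactSupport (HasCompactSupport.of_compactSpace _)

/-- The continuous linear functional on `C(𝕋)` given by a complex measure. -/
noncomputable def integralCLM (μ : ComplexMeasure UnitAddCircle) : C(UnitAddCircle, ℂ) →L[ℂ] ℂ :=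
  LinearMap.mkContinuous
    { toFun := fun f => ∫ᵛ x, f x ∂[ContinuousLinearMap.mul ℝ ℂ; μ]
      map_add' := fun f g => VectorMeasure.integral_fun_add
        (integrable_continuousMap_variation μ f) (integrable_continuousMap_variation μ g)
      map_smul' := fun c f => integral_const_mul_complexMeasure μ c f }
    (μ.variation.real Set.univ) fun f => by
      have h := VectorMeasure.norm_integral_le_of_norm_le_const (μ := μ)
        (B := ContinuousLinearMap.mul ℝ ℂ) (Eventually.of_forall f.norm_coe_le_norm)
      rw [ContinuousLinearMap.opNorm_mul, mul_one, mul_comm] at h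
      exact h

lemma integralCLM_apply (μ : ComplexMeasure UnitAddCircle) (f : C(UnitAddCircle, ℂ)) :
    integralCLM μ f = ∫ᵛ x, f x ∂[ContinuousLinearMap.mul ℝ ℂ; μ] := rfl

lemma integralCLM_fourier (μ : ComplexMeasure UnitAddCircle) (n : ℤ) :
    integralCLM μ (fourier n) = UnilateralUniqueness.fourierStieltjesCoeff μ (-n) := by
  rw [UnilateralUniqueness.fourierStieltjesCoeff, neg_neg, integralCLM_apply]

/-- A complex measure on the circle is determined by its integrals of continuous functions. -/
theorem complexMeasure_eq_zero_of_integralCLM_eq_zero {μ : ComplexMeasure UnitAddCircle}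
    (h : integralCLM μ = 0) : μ = 0 := by
  ext s hs
  set f : UnitAddCircle → ℂ := s.indicator fun _ => 1 with hf
  have hfi : μ.Integrable f := (integrable_const 1).indicator hs
  have hμs : ∫ᵛ x, f x ∂[ContinuousLinearMap.mul ℝ ℂ; μ] = μ s := by
    rw [VectorMeasure.integral_eq_setToFun]
    refine (setToFun_indicator_const _ hs (measure_ne_top _ _) (1 : ℂ)).trans ?_
    rw [transpose_eq_cbmApplyMeasure]
    simp
  rw [FunLike.coe_zero, Pi.zero_apply, ← norm_le_zero_iff]
  refine le_of_forall_pos_le_add fun ε hε => ?_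
  -- Continuous functions are dense in `L¹` of the variation, so they approximate the indicator of
  -- `s`.
  obtain ⟨g, hg, hgi⟩ := hfi.exists_boundedContinuous_integral_sub_le hε
  have hg0 : ∫ᵛ x, g x ∂[ContinuousLinearMap.mul ℝ ℂ; μ] = 0 :=
    DFunLike.congr_fun h g.toContinuousMap
  have hsub := VectorMeasure.integral_fun_sub (B := ContinuousLinearMap.mul ℝ ℂ) hfi hgi
  rw [hg0, sub_zero, hμs] at hsub
  rw [← hsub, zero_add]
  refine VectorMeasure.norm_integral_le_integral_norm.trans ?_
  rwa [ContinuousLinearMap.opNorm_mul, one_mul]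

/-- A complex measure on the circle with vanishing Fourier coefficients is zero. -/
theorem complexMeasure_eq_zero_of_fourierStieltjesCoeff_eq_zero {μ : ComplexMeasure UnitAddCircle}
    (h : ∀ n, UnilateralUniqueness.fourierStieltjesCoeff μ n = 0) : μ = 0 := by
  apply complexMeasure_eq_zero_of_integralCLM_eq_zero
  refine ContinuousLinearMap.ext_on (s := Set.range (fourier (T := (1 : ℝ)))) ?_ ?_
  · rw [Submodule.dense_iff_topologicalClosure_eq_top]
    exact span_fourier_closure_eq_top
  · rintro _ ⟨n, rfl⟩
    rw [integralCLM_fourier, h]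
    rfl

open Polynomial in
lemma sum_coeff_mul_fourierStieltjesCoeff (μ : ComplexMeasure UnitAddCircle) (p : ℂ[X]) (N : ℕ)
    (n : ℤ) :
    ∑ k ∈ Finset.range (p.natDegree + 1),
        p.coeff k * UnilateralUniqueness.fourierStieltjesCoeff μ (n + k * N) =
      ∫ᵛ x, p.eval (fourier 1 (-(N • x))) * fourier (-n) x
        ∂[ContinuousLinearMap.mul ℝ ℂ; μ] := by
  have hpow (k : ℕ) (x : UnitAddCircle) :
      (fourier (-(n + k * N)) x : ℂ) = fourier 1 (-(N • x)) ^ k * fourier (-n) x := by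
    simp only [fourier_apply, ← Circle.coe_pow, ← Circle.coe_mul, ← AddCircle.toCircle_nsmul,
      ← AddCircle.toCircle_add]
    congr 2
    simp only [← natCast_zsmul, ← neg_smul, smul_smul, ← add_smul]
    congr 1
    ring
  have hfun : (fun x : UnitAddCircle => p.eval (fourier 1 (-(N • x)) : ℂ) * fourier (-n) x) =
      ⇑(∑ k ∈ Finset.range (p.natDegree + 1), p.coeff k • fourier (T := (1 : ℝ)) (-(n + k * N))) := by
    ext x
    rw [eval_eq_sum_range, Finset.sum_mul, ContinuousMap.sum_apply]
    refine Finset.sum_congr rfl fun k _ => ?_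
    rw [ContinuousMap.smul_apply, hpow, smul_eq_mul, mul_assoc]
  rw [hfun, ← integralCLM_apply, map_sum]
  refine Finset.sum_congr rfl fun k _ => ?_
  rw [map_smul, integralCLM_fourier, neg_neg, smul_eq_mul]

open Polynomial in
/-- Quantitative unilateral estimate: if `μ` lives off `U_{N,δ}`, where `p(ζ^{-N})` is at most `ε`,
then `μ̂(n)` is controlled by the coefficients `μ̂(n + kN)` with `k ≥ 1`. -/
lemma norm_fourierStieltjesCoeff_le {μ : ComplexMeasure UnitAddCircle} {p : ℂ[X]} {N : ℕ} {n : ℤ}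
    {r ε a : ℝ} (hp0 : p.coeff 0 = 1)
    (hp : ∀ y : UnitAddCircle, r ≤ ‖y‖ → ‖p.eval (fourier 1 y)‖ ≤ ε)
    (hμ : ∀ᵐ x ∂μ.variation, r ≤ ‖N • x‖)
    (ha : ∀ k : ℕ, ‖UnilateralUniqueness.fourierStieltjesCoeff μ (n + (k + 1 : ℕ) * N)‖ ≤ a) :
    ‖UnilateralUniqueness.fourierStieltjesCoeff μ n‖ ≤
      ε * μ.variation.real Set.univ + (∑ k ∈ Finset.range p.natDegree, ‖p.coeff (k + 1)‖) * a := by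
  have hsum := sum_coeff_mul_fourierStieltjesCoeff μ p N n
  rw [Finset.sum_range_succ', hp0, one_mul, Nat.cast_zero, zero_mul, add_zero,
    ← eq_sub_iff_add_eq'] at hsum
  rw [hsum]
  refine (norm_sub_le _ _).trans (add_le_add ?_ ?_)
  · have h := VectorMeasure.norm_integral_le_of_norm_le_const (μ := μ)
      (B := ContinuousLinearMap.mul ℝ ℂ) (C := ε)
      (f := fun x => p.eval (fourier 1 (-(N • x))) * fourier (-n) x) (by
        filter_upwards [hμ] with x hx
        rw [norm_mul, norm_fourier_apply, mul_one]
        exact hp _ (by rwa [norm_neg]))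
    rwa [ContinuousLinearMap.opNorm_mul, mul_one] at h
  · rw [Finset.sum_mul]
    refine (norm_sum_le _ _).trans (Finset.sum_le_sum fun k _ => ?_)
    rw [norm_mul]
    exact mul_le_mul_of_nonneg_left (ha k) (norm_nonneg _)

lemma ae_le_norm_nsmul_of_isSupportedOn {μ : ComplexMeasure UnitAddCircle} {N : ℕ → ℕ}
    {δ : ℕ → ℝ}
    (h : UnilateralUniqueness.IsSupportedOn μ (UnilateralUniqueness.exceptionalSet N δ)) (j : ℕ) :
    ∀ᵐ x ∂μ.variation, δ j / 2 ≤ ‖N j • x‖ := by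
  have h' : ∀ᵐ x ∂μ.variation, x ∈ UnilateralUniqueness.exceptionalSet N δ := h
  filter_upwards [h'] with x hx
  exact not_lt.1 (Set.mem_iInter.1 hx j)

theorem mainTheorem6
    (Ω : ℕ → ℝ)
    (hΩ_pos : ∀ n : ℕ, 1 ≤ n → 0 < Ω n)
    (hΩ_anti : AntitoneOn Ω (Set.Ici 1))
    (hΩ_lim : Tendsto Ω atTop (𝓝 0))
    (δ : ℕ → ℝ)
    (hδ_pos : ∀ j : ℕ, 0 < δ j)
    (hδ_summable : Summable δ)
    (hδ_sum : ∑' j, δ j < 1) :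
    ∃ N : ℕ → ℕ, (∀ j : ℕ, 0 < N j) ∧
      ∀ μ : ComplexMeasure UnitAddCircle,
        UnilateralUniqueness.IsSupportedOn μ (UnilateralUniqueness.exceptionalSet N δ) →
        (∀ n : ℕ, 1 ≤ n → ‖UnilateralUniqueness.fourierStieltjesCoeff μ (n : ℤ)‖ ≤ Ω n) →
        μ = 0 := by
  have hpoly (j : ℕ) := exists_polynomial_norm_le_off_arc (half_pos (hδ_pos j))
    (show (0 : ℝ) < 1 / (j + 1) by positivity)
  choose p hp0 hp using hpoly
  -- The polynomials are fixed before the `N j`, so decay can absorb their coefficients.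
  have hM (j : ℕ) : ∃ M : ℕ, 1 ≤ M ∧
      (∑ k ∈ Finset.range (p j).natDegree, ‖(p j).coeff (k + 1)‖) * Ω M ≤ 1 / (j + 1) := by
    have hlim := hΩ_lim.const_mul (∑ k ∈ Finset.range (p j).natDegree, ‖(p j).coeff (k + 1)‖)
    rw [mul_zero] at hlim
    have hev := hlim.eventually (ge_mem_nhds (show (0 : ℝ) < 1 / (j + 1) by positivity))
    exact ((eventually_ge_atTop 1).and hev).exists
  choose M hM1 hM using hM
  -- The extra `j` offsets a negative `n`: once `j ≥ |n|`, every `n + (k + 1) * N j` is at least `M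
  -- j`.
  refine ⟨fun j => M j + j, fun j => Nat.add_pos_left (hM1 j) j, fun μ hμ hdecay => ?_⟩
  refine complexMeasure_eq_zero_of_fourierStieltjesCoeff_eq_zero fun n => ?_
  rw [← norm_le_zero_iff]
  have hlim : Tendsto (fun j : ℕ => (1 / (j + 1) : ℝ) * μ.variation.real Set.univ + 1 / (j + 1))
      atTop (𝓝 0) := by
    have h := tendsto_one_div_add_atTop_nhds_zero_nat (𝕜 := ℝ)
    simpa only [zero_mul, add_zero] using (h.mul_const (μ.variation.real Set.univ)).add h
  refine ge_of_tendsto hlim ?_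
  filter_upwards [eventually_ge_atTop n.natAbs] with j hj
  refine (norm_fourierStieltjesCoeff_le (hp0 j) (hp j) (ae_le_norm_nsmul_of_isSupportedOn hμ j)
    (a := Ω (M j)) fun k => ?_).trans (by gcongr; exact hM j)
  have hle : (M j : ℤ) ≤ n + (k + 1 : ℕ) * (M j + j : ℕ) := by
    have h1 : (M j + j : ℕ) ≤ (k + 1) * (M j + j) := Nat.le_mul_of_pos_left _ k.succ_pos
    have h2 : ((M j + j : ℕ) : ℤ) ≤ (k + 1 : ℕ) * (M j + j : ℕ) := by exact_mod_cast h1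
    omega
  obtain ⟨m, hm⟩ := Int.eq_ofNat_of_zero_le ((Int.natCast_nonneg _).trans hle)
  rw [hm] at hle ⊢
  have hMm : M j ≤ m := by exact_mod_cast hle
  exact (hdecay m ((hM1 j).trans hMm)).trans (hΩ_anti (hM1 j) ((hM1 j).trans hMm) hMm)
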